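/- Let $E$ be a complex Hilbert space of finite dimension $d$, and let $\mathcal L(E)$ be the algebra of linear operators on $E$. Let $L^2(E)$ and $L^2(\mathcal L(E))$ be the spaces of square integrable functions on the unit circle $\mathbb T$ (with normalized Lebesgue measure) with values in $E$ and $\mathcal L(E)$, and let $H^2(E)$, $H^2(\mathcal L(E))$ be their subspaces of functions with vanishing negative Fourier coefficients. Let $\Theta\in H^2(\mathcal L(E))$ be an inner function, i.e. $\Theta(\zeta)$ is unitary for almost every $\zeta\in\mathbb T$, and suppose that $\Theta$ is pure, i.e. $\|\Theta(0)\|<1$. Let $\mathcal K_\Theta=H^2(E)\ominus\Theta H^2(E)$ be the model space and let $P_\Theta$ be the orthogonal projection of $L^2(E)$ onto $\mathcal K_\Theta$. Let $\mathcal{MT}(\mathcal K_\Theta)$ be the space of matrix-valued truncated Toeplitz operators on $\mathcal K_\Theta$: the bounded operators $A$ on $\mathcal K_\Theta$ for which there is $\Phi\in L^2(\mathcal L(E))$ such that $Af=P_\Theta(\Phi f)$ for every bounded function $f\in\mathcal K_\Theta$. If $\mathcal K_\Theta$ is finite dimensional, of dimension $n$, then $\mathcal{MT}(\mathcal K_\Theta)$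 is finite dimensional and $$\dim\mathcal{MT}(\mathcal K_\Theta)=2nd-d^2 .$$ -/

import Mathlib

open MeasureTheory AddCircle
open scoped ENNReal InnerProductSpace

noncomputable section

namespace MTTO

instance factTwoPiPos : Fact (0 < 2 * Real.pi) := ⟨Real.two_pi_pos⟩

/-- The unit circle, parametrised by `t ↦ e^{it}`, `t ∈ ℝ / 2πℤ`. -/
abbrev Torus : Type := AddCircle (2 * Real.pi)

/-- Normalised Lebesgue measure `dt / 2π` on the unit circle. -/
abbrev torusMeasure : Measure Torus := haarAddCircle

section Hilbert

/-- `L²(F)`: square integrable `F`-valued functions on the unit circle, modulo equality almost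
everywhere. It is used both for `F = E` and for `F = ℒ(E)`. -/
abbrev LTwo (F : Type*) [NormedAddCommGroup F] : Type _ := Lp F 2 torusMeasure

variable {F : Type*} [NormedAddCommGroup F]

theorem integrable_lTwo (f : LTwo F) : Integrable f torusMeasure :=
  (Lp.memLp f).integrable (by norm_num)

variable [NormedSpace ℂ F]

theorem norm_fourierCoeff_le (f : LTwo F) (n : ℤ) : ‖fourierCoeff f n‖ ≤ ‖f‖ := by
  have h1 : ‖fourierCoeff f n‖ ≤ ∫ t, ‖f t‖ ∂torusMeasure := by
    refine (norm_integral_le_integral_norm _).trans (le_of_eq ?_)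
    refine integral_congr_ae (Filter.Eventually.of_forall fun t => ?_)
    simp only [norm_smul, fourier_apply, Circle.norm_coe, one_mul]
  have h2 : ∫ t, ‖f t‖ ∂torusMeasure = (eLpNorm f 1 torusMeasure).toReal := by
    rw [eLpNorm_one_eq_lintegral_enorm,
      integral_norm_eq_lintegral_enorm (Lp.aestronglyMeasurable f)]
  rw [Lp.norm_def]
  refine (h1.trans_eq h2).trans (ENNReal.toReal_mono (Lp.eLpNorm_ne_top f) ?_)
  exact eLpNorm_le_eLpNorm_of_exponent_le (by norm_num) (Lp.aestronglyMeasurable f)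

/-- The `n`-th Fourier coefficient `f ↦ (2π)⁻¹ ∫ e^{-int} f(e^{it}) dt`, as a bounded linear map
on `L²(F)`. -/
def coeffL (n : ℤ) : LTwo F →L[ℂ] F :=
  LinearMap.mkContinuous
    { toFun := fun f => fourierCoeff f n
      map_add' := fun f g => by
        rw [fourierCoeff_congr_ae (Lp.coeFn_add f g),
          fourierCoeff.add (integrable_lTwo f) (integrable_lTwo g), Pi.add_apply]
      map_smul' := fun c f => by
        rw [fourierCoeff_congr_ae (Lp.coeFn_smul c f)]
        exact fourierCoeff.const_smul f c n }
    1 (fun f => by simpa using norm_fourierCoeff_le f n)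

@[simp] theorem coeffL_apply (n : ℤ) (f : LTwo F) : coeffL n f = fourierCoeff f n := rfl

variable (F) in
/-- The Hardy space `H²(F)`: the functions in `L²(F)` whose negative Fourier coefficients
vanish. -/
def hardy : Submodule ℂ (LTwo F) where
  carrier := {f | ∀ n : ℤ, n < 0 → fourierCoeff f n = 0}
  zero_mem' := fun n _ => by rw [← coeffL_apply, map_zero]
  add_mem' := fun {f g} hf hg n hn => by
    rw [← coeffL_apply, map_add, coeffL_apply, coeffL_apply, hf n hn, hg n hn, add_zero]
  smul_mem' := fun c f hf n hn => by
    rw [← coeffL_apply, map_smul, coeffL_apply, hf n hn, smul_zero]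

theorem isClosed_hardy : IsClosed (hardy F : Set (LTwo F)) := by
  have h : (hardy F : Set (LTwo F)) = ⋂ (n : ℤ) (_ : n < 0), {f | coeffL n f = 0} := by
    ext f
    simp [hardy]
  rw [h]
  exact isClosed_iInter fun n => isClosed_iInter fun _ =>
    isClosed_eq (coeffL n).continuous continuous_const

/-- The value at the point `z` of the open unit disc of the analytic function whose boundary
function is `f ∈ H²(F)`. -/
def discValue (f : LTwo F) (z : ℂ) : F := ∑' n : ℕ, z ^ n • fourierCoeff f n

end Hilbert

variable {E : Type*} [NormedAddCommGroup E] [InnerProductSpace ℂ E]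

/-- `Θ` is pure: `‖Θ(0)‖ < 1`. -/
def IsPure (Θ : LTwo (E →L[ℂ] E)) : Prop := ‖discValue Θ 0‖ < 1

/-- The subspace `Θ H²(E) = {Θ f : f ∈ H²(E)}` of `L²(E)`. -/
def mulHardy (Θ : LTwo (E →L[ℂ] E)) : Submodule ℂ (LTwo E) where
  carrier := {g | ∃ f ∈ hardy E, g =ᵐ[torusMeasure] fun t => Θ t (f t)}
  zero_mem' := ⟨0, zero_mem _, by
    filter_upwards [Lp.coeFn_zero E 2 torusMeasure] with t ht
    rw [ht, Pi.zero_apply, map_zero]⟩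
  add_mem' := by
    rintro g₁ g₂ ⟨f₁, hf₁, h₁⟩ ⟨f₂, hf₂, h₂⟩
    refine ⟨f₁ + f₂, add_mem hf₁ hf₂, ?_⟩
    filter_upwards [h₁, h₂, Lp.coeFn_add g₁ g₂, Lp.coeFn_add f₁ f₂] with t a b c e
    rw [c, Pi.add_apply, a, b, e, Pi.add_apply, map_add]
  smul_mem' := by
    rintro c g ⟨f, hf, h⟩
    refine ⟨c • f, Submodule.smul_mem _ c hf, ?_⟩
    filter_upwards [h, Lp.coeFn_smul c g, Lp.coeFn_smul c f] with t a b e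
    rw [b, Pi.smul_apply, a, e, Pi.smul_apply, map_smul]

/-- The model space `K_Θ = H²(E) ⊖ Θ H²(E)`. -/
def modelSpace (Θ : LTwo (E →L[ℂ] E)) : Submodule ℂ (LTwo E) := hardy E ⊓ (mulHardy Θ)ᗮ

theorem isClosed_modelSpace (Θ : LTwo (E →L[ℂ] E)) :
    IsClosed (modelSpace Θ : Set (LTwo E)) :=
  isClosed_hardy.inter (Submodule.isClosed_orthogonal _)

/-- The function `f` is (essentially) bounded. -/
def IsBdd (f : LTwo E) : Prop := MemLp f ∞ torusMeasure

theorem memLp_mul (Φ : LTwo (E →L[ℂ] E)) {f : LTwo E} (hf : IsBdd f) :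
    MemLp (fun t => Φ t (f t)) 2 torusMeasure :=
  (ContinuousLinearMap.id ℂ (E →L[ℂ] E)).memLp_of_bilin 2 (Lp.memLp Φ) hf

/-- The product `Φ f ∈ L²(E)` of `Φ ∈ L²(ℒ(E))` and a bounded function `f`. -/
def mulBdd (Φ : LTwo (E →L[ℂ] E)) (f : LTwo E) (hf : IsBdd f) : LTwo E :=
  (memLp_mul Φ hf).toLp _

variable [CompleteSpace E]

/-- `Θ` is inner: `Θ ∈ H²(ℒ(E))` and its boundary values are almost everywhere unitary. -/
def IsInner (Θ : LTwo (E →L[ℂ] E)) : Prop :=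
  Θ ∈ hardy (E →L[ℂ] E) ∧ ∀ᵐ t ∂torusMeasure, Θ t ∈ unitary (E →L[ℂ] E)

instance completeSpace_modelSpace (Θ : LTwo (E →L[ℂ] E)) : CompleteSpace (modelSpace Θ) :=
  (isClosed_modelSpace Θ).completeSpace_coe

/-- The orthogonal projection `P_Θ` of `L²(E)` onto `K_Θ`. -/
def modelProj (Θ : LTwo (E →L[ℂ] E)) : LTwo E →L[ℂ] modelSpace Θ :=
  (modelSpace Θ).orthogonalProjectionOnto

/-- `Φ` is a symbol of the bounded operator `A` on `K_Θ`, that is `A = A_Φ`: one has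
`A f = P_Θ (Φ f)` for all bounded functions `f` in `K_Θ`. -/
def IsSymbol (Θ Φ : LTwo (E →L[ℂ] E)) (A : modelSpace Θ →L[ℂ] modelSpace Θ) : Prop :=
  ∀ (f : modelSpace Θ) (hf : IsBdd (f : LTwo E)), A f = modelProj Θ (mulBdd Φ f hf)

/-- The space `MT(K_Θ)` of all matrix-valued truncated Toeplitz operators on `K_Θ`: the bounded
operators on `K_Θ` that have a symbol in `L²(ℒ(E))`. -/
def toeplitzSpace (Θ : LTwo (E →L[ℂ] E)) :
    Submodule ℂ (modelSpace Θ →L[ℂ] modelSpace Θ) where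
  carrier := {A | ∃ Φ : LTwo (E →L[ℂ] E), IsSymbol Θ Φ A}
  zero_mem' := by
    refine ⟨0, fun f hf => ?_⟩
    have h : mulBdd (0 : LTwo (E →L[ℂ] E)) (f : LTwo E) hf = 0 := by
      apply Lp.ext
      filter_upwards [MemLp.coeFn_toLp (memLp_mul 0 hf), Lp.coeFn_zero E 2 torusMeasure,
        Lp.coeFn_zero (E →L[ℂ] E) 2 torusMeasure] with t a b c
      rw [b, mulBdd, a, c]
      rfl
    simp [h]
  add_mem' := by
    rintro A B ⟨Φ, hA⟩ ⟨Ψ, hB⟩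
    refine ⟨Φ + Ψ, fun f hf => ?_⟩
    have h : mulBdd (Φ + Ψ) (f : LTwo E) hf = mulBdd Φ f hf + mulBdd Ψ f hf := by
      apply Lp.ext
      filter_upwards [MemLp.coeFn_toLp (memLp_mul (Φ + Ψ) hf), MemLp.coeFn_toLp (memLp_mul Φ hf),
        MemLp.coeFn_toLp (memLp_mul Ψ hf), Lp.coeFn_add Φ Ψ,
        Lp.coeFn_add (mulBdd Φ f hf) (mulBdd Ψ f hf)] with t a b c e k
      rw [k, Pi.add_apply, mulBdd, mulBdd, mulBdd, a, b, c, e]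
      rfl
    simp [h, hA f hf, hB f hf]
  smul_mem' := by
    rintro c A ⟨Φ, hA⟩
    refine ⟨c • Φ, fun f hf => ?_⟩
    have h : mulBdd (c • Φ) (f : LTwo E) hf = c • mulBdd Φ f hf := by
      apply Lp.ext
      filter_upwards [MemLp.coeFn_toLp (memLp_mul (c • Φ) hf), MemLp.coeFn_toLp (memLp_mul Φ hf),
        Lp.coeFn_smul c Φ, Lp.coeFn_smul c (mulBdd Φ f hf)] with t a b e k
      rw [k, Pi.smul_apply, mulBdd, mulBdd, a, b, e]
      rfl
    simp [h, hA f hf]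

end MTTO

end

open MeasureTheory AddCircle
open scoped ENNReal InnerProductSpace

noncomputable section

/-! The proof is a displacement argument. Let `T` be the backward shift `f ↦ (f - f(0)) / z` on
`K_Θ`, and let `J e = P_Θ e` for constants `e`; its adjoint is `J† f = f(0)`. A Toeplitz form is
unchanged when both arguments are multiplied by the same character, so `A - T† A T` only sees
constant terms: for every truncated Toeplitz `A` it has the form `J X + Y J†`
(`displacement_toeplitzOp`).

Conversely, the analytic symbol `e ↦ Y e` has displacement `Y J†`
(`displacement_toeplitzOp_analyticSymbol`), and taking adjoints yields every `J X`. When `K_Θ` is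
finite dimensional, the powers of `T` are summable in norm, which makes the displacement map
injective (`displacement_injective`) and all functions in `K_Θ` bounded (`isBdd_of_mem_modelSpace`).

Hence the dimension sought is the rank of `(X, Y) ↦ J X + Y J†` on a space of dimension `2nd`.
Purity makes `J` injective (`defect_injective`), so the kernel is `{(-M J†, J M)}`, of dimension
`d²` (`range_defectKer`). -/

namespace MTTO

/-! ### Fourier coefficients and multiplication by characters -/

section Fourier

variable {F : Type*} [NormedAddCommGroup F] [NormedSpace ℂ F]

/-- The constant function with value `e`, as an element of `L²(F)`. -/
def constTwo : F →L[ℂ] LTwo F := Lp.constL 2 torusMeasure ℂ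

theorem coeFn_constTwo (e : F) : constTwo e =ᵐ[torusMeasure] fun _ => e :=
  Lp.coeFn_const 2 torusMeasure e

theorem integral_fourier (n : ℤ) :
    ∫ t : Torus, fourier n t ∂torusMeasure = if n = 0 then 1 else 0 := by
  have h := congrFun (fourierCoeff_fourier (T := 2 * Real.pi) n) 0
  simpa [fourierCoeff, Pi.single_apply, eq_comm] using h

theorem fourierCoeff_fourier_smul_const [CompleteSpace F] (m n : ℤ) (e : F) :
    fourierCoeff (fun t : Torus => fourier m t • e) n = if n = m then e else 0 := by
  have h : ∀ t : Torus, (fourier (-n) t : ℂ) • (fourier m t : ℂ) • e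
      = (fourier (m - n) t : ℂ) • e := fun t => by
    rw [smul_smul, ← fourier_add]
    congr 3
    ring
  simp only [fourierCoeff, h]
  rw [integral_smul_const, integral_fourier]
  by_cases hmn : n = m
  · simp [hmn]
  · rw [if_neg (by omega), if_neg hmn, zero_smul]

theorem fourierCoeff_constTwo [CompleteSpace F] (e : F) (n : ℤ) :
    fourierCoeff (constTwo e) n = if n = 0 then e else 0 := by
  rw [fourierCoeff_congr_ae (coeFn_constTwo e), ← fourierCoeff_fourier_smul_const 0 n e]
  simp

/-- Multiplication by the character `e^{ikt}`, as a linear map on `L²(F)`. -/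
def charMul (k : ℤ) : LTwo F →ₗ[ℂ] LTwo F where
  toFun f := fourierLp ∞ k • f
  map_add' f g := Lp.add_smul _ f g
  map_smul' c f := (Lp.smul_comm c _ f).symm

theorem coeFn_charMul (k : ℤ) (f : LTwo F) :
    charMul k f =ᵐ[torusMeasure] fun t => (fourier k t : ℂ) • f t := by
  have h : charMul k f =ᵐ[torusMeasure] (fourierLp ∞ k : Torus → ℂ) • (f : Torus → F) :=
    Lp.coeFn_lpSMul (fourierLp ∞ k) f
  filter_upwards [h, coeFn_fourierLp (T := 2 * Real.pi) ∞ k] with t a b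
  rw [a, Pi.smul_apply', b]

theorem fourierCoeff_charMul (k : ℤ) (f : LTwo F) (n : ℤ) :
    fourierCoeff (charMul k f) n = fourierCoeff f (n - k) := by
  rw [fourierCoeff_congr_ae (coeFn_charMul k f)]
  refine integral_congr_ae (Filter.Eventually.of_forall fun t => ?_)
  simp only [smul_smul, ← fourier_add]
  congr 3
  ring

theorem fourierCoeff_compLp [CompleteSpace F] {G : Type*} [NormedAddCommGroup G] [NormedSpace ℂ G]
    [CompleteSpace G] (L : F →L[ℂ] G) (f : LTwo F) (n : ℤ) :
    fourierCoeff (L.compLp f) n = L (fourierCoeff f n) := by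
  rw [fourierCoeff_congr_ae (L.coeFn_compLp f), fourierCoeff, fourierCoeff,
    ← ContinuousLinearMap.integral_comp_comm L ((integrable_lTwo f).fourier_smul (-n))]
  simp only [map_smul]

theorem charMul_mem_hardy {f : LTwo F} (hf : f ∈ hardy F) {k : ℤ} (hk : 0 ≤ k) :
    charMul k f ∈ hardy F := fun n hn => by
  rw [fourierCoeff_charMul, hf _ (by omega)]

theorem constTwo_mem_hardy [CompleteSpace F] (e : F) : constTwo e ∈ hardy F := fun n hn => by
  rw [fourierCoeff_constTwo, if_neg hn.ne]

end Fourier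

/-! ### Parseval's identity and products of analytic functions -/

section Parseval

variable {E : Type*} [NormedAddCommGroup E] [InnerProductSpace ℂ E]

theorem inner_charMul_charMul (k : ℤ) (f g : LTwo E) :
    ⟪charMul k f, charMul k g⟫_ℂ = ⟪f, g⟫_ℂ := by
  rw [L2.inner_def, L2.inner_def]
  refine integral_congr_ae ?_
  filter_upwards [coeFn_charMul k f, coeFn_charMul k g] with t a b
  rw [a, b, inner_smul_left, inner_smul_right, ← mul_assoc, ← fourier_neg, ← fourier_add]
  simp

theorem inner_charMul_neg_right (k : ℤ) (f g : LTwo E) :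
    ⟪f, charMul (-k) g⟫_ℂ = ⟪charMul k f, g⟫_ℂ := by
  rw [L2.inner_def, L2.inner_def]
  refine integral_congr_ae ?_
  filter_upwards [coeFn_charMul (-k) g, coeFn_charMul k f] with t a b
  rw [a, b, inner_smul_left, inner_smul_right, fourier_neg]

theorem hasSum_inner_fourierCoeff_scalar (f g : LTwo ℂ) :
    HasSum (fun n : ℤ => ⟪fourierCoeff f n, fourierCoeff g n⟫_ℂ) ⟪f, g⟫_ℂ := by
  convert! fourierBasis.hasSum_inner_mul_inner f g using 2 with n
  rw [← inner_conj_symm f, ← HilbertBasis.repr_apply_apply, ← HilbertBasis.repr_apply_apply,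
    fourierBasis_repr, fourierBasis_repr, RCLike.inner_apply']

variable [FiniteDimensional ℂ E]

/-- Parseval's identity in `L²(E)`. -/
theorem hasSum_inner_fourierCoeff [CompleteSpace E] (f g : LTwo E) :
    HasSum (fun n : ℤ => ⟪fourierCoeff f n, fourierCoeff g n⟫_ℂ) ⟪f, g⟫_ℂ := by
  let b := stdOrthonormalBasis ℂ E
  -- Scalar Parseval holds in each coordinate of an orthonormal basis; the coordinates are then
  -- summed.
  have key : ∀ i, HasSum
      (fun n : ℤ => ⟪⟪b i, fourierCoeff f n⟫_ℂ, ⟪b i, fourierCoeff g n⟫_ℂ⟫_ℂ)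
      ⟪(innerSL ℂ (b i)).compLp f, (innerSL ℂ (b i)).compLp g⟫_ℂ := fun i => by
    have h := hasSum_inner_fourierCoeff_scalar ((innerSL ℂ (b i)).compLp f)
      ((innerSL ℂ (b i)).compLp g)
    simpa only [fourierCoeff_compLp, innerSL_apply_apply] using h
  have hsum := hasSum_sum fun i (_ : i ∈ Finset.univ) => key i
  have hE : ∀ x y : E, ∑ i, ⟪⟪b i, x⟫_ℂ, ⟪b i, y⟫_ℂ⟫_ℂ = ⟪x, y⟫_ℂ := fun x y => by
    rw [← b.sum_inner_mul_inner x y]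
    refine Finset.sum_congr rfl fun i _ => ?_
    rw [RCLike.inner_apply', inner_conj_symm]
  simp only [hE] at hsum
  convert! hsum using 1
  simp only [L2.inner_def]
  rw [← integral_finsetSum _ fun i _ => L2.integrable_inner _ _]
  refine integral_congr_ae ?_
  have hae := ae_all_iff.2 fun i => (innerSL ℂ (b i)).coeFn_compLp f
  have hae' := ae_all_iff.2 fun i => (innerSL ℂ (b i)).coeFn_compLp g
  filter_upwards [hae, hae'] with t h h'
  simp only [h, h', innerSL_apply_apply, hE]

variable [CompleteSpace E]

theorem inner_eq_of_fourierCoeff {f g : LTwo E}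
    (h : ∀ n : ℤ, n ≠ 0 → fourierCoeff f n = 0 ∨ fourierCoeff g n = 0) :
    ⟪f, g⟫_ℂ = ⟪fourierCoeff f 0, fourierCoeff g 0⟫_ℂ := by
  refine (hasSum_inner_fourierCoeff f g).unique (hasSum_single 0 fun n hn => ?_)
  rcases h n hn with h | h <;> simp [h]

theorem eq_zero_of_fourierCoeff {f : LTwo E} (h : ∀ n : ℤ, fourierCoeff f n = 0) : f = 0 := by
  have := inner_eq_of_fourierCoeff (f := f) (g := f) fun n _ => Or.inl (h n)
  rwa [h, inner_zero_left, inner_self_eq_zero] at this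

theorem ext_fourierCoeff {f g : LTwo E} (h : ∀ n : ℤ, fourierCoeff f n = fourierCoeff g n) :
    f = g := by
  refine sub_eq_zero.1 (eq_zero_of_fourierCoeff fun n => ?_)
  rw [← coeffL_apply, map_sub, coeffL_apply, coeffL_apply, h, sub_self]

theorem inner_constTwo_left (e : E) (f : LTwo E) :
    ⟪constTwo e, f⟫_ℂ = ⟪e, fourierCoeff f 0⟫_ℂ := by
  rw [inner_eq_of_fourierCoeff fun n hn => Or.inl (by rw [fourierCoeff_constTwo, if_neg hn]),
    fourierCoeff_constTwo, if_pos rfl]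

theorem tendsto_fourierCoeff (f : LTwo E) :
    Filter.Tendsto (fun n : ℕ => fourierCoeff f n) Filter.atTop (nhds 0) := by
  have h := (hasSum_inner_fourierCoeff f f).summable.comp_injective
    (i := fun n : ℕ => (n : ℤ)) Nat.cast_injective
  have h0 := h.tendsto_atTop_zero.norm
  simp only [Function.comp_def, norm_zero, inner_self_eq_norm_sq_to_K,
    norm_pow, RCLike.norm_ofReal, abs_norm] at h0
  have h1 := h0.sqrt
  simp only [Real.sqrt_sq (norm_nonneg _), Real.sqrt_zero] at h1
  exact tendsto_zero_iff_norm_tendsto_zero.2 h1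

/-- The zeroth Fourier coefficient of a product of analytic functions. -/
theorem integral_apply_of_mem_hardy {Φ : LTwo (E →L[ℂ] E)} (hΦ : Φ ∈ hardy (E →L[ℂ] E))
    {f : LTwo E} (hf : f ∈ hardy E) :
    ∫ t, Φ t (f t) ∂torusMeasure = fourierCoeff Φ 0 (fourierCoeff f 0) := by
  have hint : Integrable (fun t => Φ t (f t)) torusMeasure :=
    memLp_one_iff_integrable.1 <|
      (ContinuousLinearMap.id ℂ (E →L[ℂ] E)).memLp_of_bilin 1 (Lp.memLp Φ) (Lp.memLp f)
  refine ext_inner_left ℂ fun e => ?_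
  -- The pairing of `e` with `Φ f` equals that of `Φ† e` with `f`. Taking adjoints moves the
  -- spectrum of `Φ` to nonpositive indices, so only index 0 is shared with `f`.
  let L : (E →L[ℂ] E) →L⋆[ℂ] E :=
    (ContinuousLinearMap.apply ℂ E e).comp
      (ContinuousLinearMap.adjoint (𝕜 := ℂ) (E := E) (F := E)).toContinuousLinearEquiv.toContinuousLinearMap
  have hL : ∀ M, L M = ContinuousLinearMap.adjoint M e := fun M => rfl
  have hcoeff : ∀ n, fourierCoeff (L.compLp Φ) n = L (fourierCoeff Φ (-n)) := fun n => by
    -- `L` is only conjugate-linear, so it is moved past the integral as a real-linear map.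
    have h := (AddMonoidHom.toRealLinearMap (L : (E →L[ℂ] E) →+ E) L.continuous).integral_comp_comm
      ((integrable_lTwo Φ).fourier_smul n)
    change ∫ t, L (fourier n t • Φ t) ∂torusMeasure = L (∫ t, fourier n t • Φ t ∂torusMeasure) at h
    rw [fourierCoeff_congr_ae (L.coeFn_compLp Φ), fourierCoeff, fourierCoeff, neg_neg, ← h]
    simp only [map_smulₛₗ, fourier_neg]
  have h1 : ⟪e, ∫ t, Φ t (f t) ∂torusMeasure⟫_ℂ = ⟪L.compLp Φ, f⟫_ℂ := by
    rw [← integral_inner hint, L2.inner_def]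
    refine integral_congr_ae ?_
    filter_upwards [L.coeFn_compLp Φ] with t a
    rw [a, hL, ContinuousLinearMap.adjoint_inner_left]
  rw [h1, inner_eq_of_fourierCoeff, hcoeff, hL, ContinuousLinearMap.adjoint_inner_left, neg_zero]
  intro n hn
  rcases lt_or_gt_of_ne hn with h | h
  · exact Or.inr (hf n h)
  · exact Or.inl (by rw [hcoeff, hΦ (-n) (by omega), map_zero])

theorem fourierCoeff_zero_of_eq_mul {Φ : LTwo (E →L[ℂ] E)} (hΦ : Φ ∈ hardy (E →L[ℂ] E))
    {f g : LTwo E} (hf : f ∈ hardy E) (hg : g =ᵐ[torusMeasure] fun t => Φ t (f t)) :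
    fourierCoeff g 0 = fourierCoeff Φ 0 (fourierCoeff f 0) := by
  rw [← integral_apply_of_mem_hardy hΦ hf, fourierCoeff_congr_ae hg]
  simp [fourierCoeff]

/-- For `n < 0`, multiplying by `e^{-int}` moves the `n`-th coefficient to index 0 and keeps `f`
analytic, now with zero constant term. -/
theorem mem_hardy_of_eq_mul {Φ : LTwo (E →L[ℂ] E)} (hΦ : Φ ∈ hardy (E →L[ℂ] E))
    {f g : LTwo E} (hf : f ∈ hardy E) (hg : g =ᵐ[torusMeasure] fun t => Φ t (f t)) :
    g ∈ hardy E := fun n hn => by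
  have h : charMul (-n) g =ᵐ[torusMeasure] fun t => Φ t (charMul (-n) f t) := by
    filter_upwards [hg, coeFn_charMul (-n) f, coeFn_charMul (-n) g] with t a b c
    rw [c, b, a, map_smul]
  have h0 := fourierCoeff_zero_of_eq_mul hΦ (charMul_mem_hardy hf (by omega)) h
  rw [fourierCoeff_charMul, fourierCoeff_charMul, hf (0 - -n) (by omega), map_zero] at h0
  simpa using h0

end Parseval

/-! ### The backward shift on the model space and boundedness of its functions -/

section ModelShift

variable {E : Type*} [NormedAddCommGroup E] [InnerProductSpace ℂ E]

section BackwardShift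

variable {F : Type*} [NormedAddCommGroup F] [NormedSpace ℂ F]

/-- The backward shift `f ↦ (f - f(0)) / z` on `L²(F)`. -/
def backShift : LTwo F →ₗ[ℂ] LTwo F :=
  charMul (-1) ∘ₗ (LinearMap.id - (constTwo ∘L coeffL 0 : LTwo F →L[ℂ] LTwo F).toLinearMap)

theorem backShift_apply (f : LTwo F) :
    backShift f = charMul (-1) (f - constTwo (fourierCoeff f 0)) := rfl

theorem fourierCoeff_sub_constTwo [CompleteSpace F] (f : LTwo F) (n : ℤ) :
    fourierCoeff (f - constTwo (fourierCoeff f 0) : LTwo F) n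
      = if n = 0 then 0 else fourierCoeff f n := by
  rw [← coeffL_apply, map_sub, coeffL_apply, coeffL_apply, fourierCoeff_constTwo]
  by_cases h : n = 0 <;> simp [h]

theorem fourierCoeff_backShift [CompleteSpace F] (f : LTwo F) (n : ℤ) :
    fourierCoeff (backShift f) n = if n = -1 then 0 else fourierCoeff f (n + 1) := by
  rw [backShift_apply, fourierCoeff_charMul, fourierCoeff_sub_constTwo, sub_neg_eq_add]
  by_cases h : n = -1
  · simp [h]
  · rw [if_neg (by omega), if_neg h]

theorem backShift_mem_hardy [CompleteSpace F] {f : LTwo F} (hf : f ∈ hardy F) :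
    backShift f ∈ hardy F := fun n hn => by
  rw [fourierCoeff_backShift]
  split_ifs with h
  · rfl
  · exact hf _ (by omega)

end BackwardShift

theorem charMul_mem_mulHardy {Θ : LTwo (E →L[ℂ] E)} {g : LTwo E} (hg : g ∈ mulHardy Θ) {k : ℤ} (hk : 0 ≤ k) :
    charMul k g ∈ mulHardy Θ := by
  obtain ⟨f, hf, h⟩ := hg
  refine ⟨charMul k f, charMul_mem_hardy hf hk, ?_⟩
  filter_upwards [h, coeFn_charMul k f, coeFn_charMul k g] with t a b c
  rw [c, b, a, map_smul]

/-- In a complex Banach algebra, the powers of an element whose spectrum lies in the open unit disc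
are absolutely summable. -/
theorem summable_norm_pow_of_spectrum {A : Type*} [NormedRing A] [NormedAlgebra ℂ A]
    [CompleteSpace A] {a : A} (ha : ∀ c ∈ spectrum ℂ a, ‖c‖ < 1) :
    Summable fun k : ℕ => ‖a ^ k‖ := by
  rcases subsingleton_or_nontrivial A with hs | hs
  · have h0 : ∀ k : ℕ, a ^ k = 0 := fun k => Subsingleton.elim _ _
    simp only [h0, norm_zero]
    exact summable_zero
  have hr : spectralRadius ℂ a < 1 := by
    rw [← ENNReal.coe_one]
    exact spectrum.spectralRadius_lt_of_forall_lt a fun c hc => ha c hc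
  obtain ⟨r, hr1, hr2⟩ := ENNReal.lt_iff_exists_nnreal_btwn.1 hr
  have hr2' : r < 1 := by exact_mod_cast hr2
  refine summable_of_isBigO_nat (NNReal.summable_coe.2 (NNReal.summable_geometric hr2')) ?_
  refine Asymptotics.IsBigO.of_bound 1 ?_
  -- Gelfand's formula: eventually `‖a ^ k‖ ≤ r ^ k` with `r < 1`.
  have h := (spectrum.pow_nnnorm_pow_one_div_tendsto_nhds_spectralRadius a).eventually_lt_const hr1
  filter_upwards [h, Filter.eventually_gt_atTop 0] with k hk hk0
  have hk' : (‖a ^ k‖₊ : ℝ≥0∞) ≤ (r : ℝ≥0∞) ^ k := by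
    have h1 := ENNReal.rpow_le_rpow hk.le (Nat.cast_nonneg k : (0 : ℝ) ≤ k)
    rwa [← ENNReal.rpow_mul, one_div_mul_cancel (by positivity), ENNReal.rpow_one,
      ENNReal.rpow_natCast] at h1
  have hk2 : ‖a ^ k‖₊ ≤ r ^ k := by exact_mod_cast hk'
  rw [one_mul, norm_norm, Real.norm_of_nonneg (by positivity)]
  exact_mod_cast hk2

theorem summable_opNorm_pow_of_spectrum {V : Type*} [NormedAddCommGroup V] [NormedSpace ℂ V]
    [CompleteSpace V] {a : V →L[ℂ] V} (ha : ∀ c ∈ spectrum ℂ a, ‖c‖ < 1) :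
    Summable fun k : ℕ => ‖a ^ k‖ :=
  summable_norm_pow_of_spectrum ha

/-- Functions with absolutely summable Fourier coefficients are bounded. -/
theorem isBdd_of_summable [FiniteDimensional ℂ E] [CompleteSpace E] {f : LTwo E}
    (hf : Summable fun n : ℤ => ‖fourierCoeff f n‖) : IsBdd f := by
  let u : ℤ → C(Torus, E) := fun n => ⟨fun t => (fourier n t : ℂ) • fourierCoeff f n, by fun_prop⟩
  have hu : ∀ n, ‖u n‖ ≤ ‖fourierCoeff f n‖ := fun n =>
    (ContinuousMap.norm_le _ (norm_nonneg _)).2 fun t => by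
      simp only [u, ContinuousMap.coe_mk, norm_smul, fourier_apply, Circle.norm_coe, one_mul,
        le_refl]
  have hs : Summable u := Summable.of_norm_bounded hf hu
  let L : C(Torus, E) →L[ℂ] LTwo E := ContinuousMap.toLp 2 torusMeasure ℂ
  have hL : ∀ g : C(Torus, E), L g =ᵐ[torusMeasure] g := fun g => ContinuousMap.coeFn_toLp _ g
  have hfg : f = L (∑' n, u n) := by
    refine ext_fourierCoeff fun m => ?_
    have h := ((hs.hasSum.mapL L).mapL (coeffL m))
    have h' : ∀ n, coeffL m (L (u n)) = if m = n then fourierCoeff f n else 0 := fun n => by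
      rw [coeffL_apply, fourierCoeff_congr_ae (hL _), ← fourierCoeff_fourier_smul_const n m]
      rfl
    simp only [h'] at h
    rw [← coeffL_apply m (L _)]
    refine HasSum.unique ?_ h
    have h1 := hasSum_single (f := fun n => if m = n then fourierCoeff f n else 0) m
      fun n hn => if_neg hn.symm
    rwa [if_pos rfl] at h1
  have hae : f =ᵐ[torusMeasure] (∑' n, u n : C(Torus, E)) := by
    conv_lhs => rw [hfg]
    exact hL _
  refine (memLp_congr_ae hae).2 (memLp_top_of_bound ?_ ‖(∑' n, u n : C(Torus, E))‖ ?_)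
  · exact (ContinuousMap.continuous _).aestronglyMeasurable
  · exact Filter.Eventually.of_forall fun t => ContinuousMap.norm_coe_le_norm _ t

variable [FiniteDimensional ℂ E] [CompleteSpace E] {Θ : LTwo (E →L[ℂ] E)}

theorem mulHardy_le_hardy (hΘ : Θ ∈ hardy (E →L[ℂ] E)) : mulHardy Θ ≤ hardy E := by
  rintro g ⟨f, hf, h⟩
  exact mem_hardy_of_eq_mul hΘ hf h

/-- For `g ∈ Θ H²`, the pairing with `g` becomes that of `z g` with `f - f(0)`. Here `z g` is again
in `Θ H²`, hence orthogonal to `f`, and it has no constant term. -/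
theorem backShift_mem_modelSpace (hΘ : Θ ∈ hardy (E →L[ℂ] E)) {f : LTwo E}
    (hf : f ∈ modelSpace Θ) : backShift f ∈ modelSpace Θ := by
  refine ⟨backShift_mem_hardy hf.1, (Submodule.mem_orthogonal _ _).2 fun g hg => ?_⟩
  have hz := charMul_mem_mulHardy hg zero_le_one
  rw [backShift_apply, inner_charMul_neg_right, inner_sub_right,
    (Submodule.mem_orthogonal _ _).1 hf.2 _ hz, zero_sub, neg_eq_zero, ← inner_conj_symm,
    inner_constTwo_left, fourierCoeff_charMul, mulHardy_le_hardy hΘ hg (0 - 1) (by norm_num),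
    inner_zero_right, map_zero]

variable [FiniteDimensional ℂ (modelSpace Θ)]

/-- The restriction of the backward shift to the model space. -/
def modelShift (hΘ : Θ ∈ hardy (E →L[ℂ] E)) : modelSpace Θ →L[ℂ] modelSpace Θ :=
  (backShift.restrict fun _ hf => backShift_mem_modelSpace hΘ hf).toContinuousLinearMap

theorem coe_modelShift (hΘ : Θ ∈ hardy (E →L[ℂ] E)) (f : modelSpace Θ) :
    (modelShift hΘ f : LTwo E) = backShift (f : LTwo E) := rfl

/-- At `n = 0` this recovers the `k`-th coefficient of `f` as the constant term of `T ^ k f`, so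
bounds on the powers of `T` control Fourier coefficients. -/
theorem fourierCoeff_modelShift_pow (hΘ : Θ ∈ hardy (E →L[ℂ] E)) (k : ℕ) (f : modelSpace Θ)
    {n : ℤ} (hn : 0 ≤ n) :
    fourierCoeff ((modelShift hΘ ^ k) f : modelSpace Θ).1 n = fourierCoeff f.1 (n + k) := by
  induction k generalizing n with
  | zero => simp
  | succ k ih =>
    rw [pow_succ', mul_apply_eq_comp, coe_modelShift, fourierCoeff_backShift,
      if_neg (by omega), ih (by omega)]
    congr 1
    push_cast
    ring

/-- In finite dimension `c` has an eigenvector `v`, with coefficients `c ^ k • v(0)`. These tend to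
0, so `‖c‖ ≥ 1` would force `v(0) = 0` and then `v = 0`. -/
theorem norm_lt_one_of_mem_spectrum_modelShift (hΘ : Θ ∈ hardy (E →L[ℂ] E)) {c : ℂ}
    (hc : c ∈ spectrum ℂ (modelShift hΘ)) : ‖c‖ < 1 := by
  have hc' : c ∈ spectrum ℂ (modelShift hΘ).toLinearMap := by
    rwa [← AlgEquiv.spectrum_eq (Module.End.toContinuousLinearMap (modelSpace Θ))
      (modelShift hΘ).toLinearMap]
  obtain ⟨v, hv⟩ := (Module.End.hasEigenvalue_iff_mem_spectrum.2 hc').exists_hasEigenvector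
  have hv1 : modelShift hΘ v = c • v := hv.apply_eq_smul
  have hpow : ∀ k : ℕ, (modelShift hΘ ^ k) v = c ^ k • v := fun k => by
    induction k with
    | zero => simp
    | succ k ih => rw [pow_succ', mul_apply_eq_comp, ih, map_smul, hv1, smul_smul,
        pow_succ]
  have hco : ∀ k : ℕ, fourierCoeff v.1 k = c ^ k • fourierCoeff v.1 0 := fun k => by
    rw [← zero_add (k : ℤ), ← fourierCoeff_modelShift_pow hΘ k v le_rfl, hpow, Submodule.coe_smul,
      ← coeffL_apply, map_smul, coeffL_apply]
  by_contra! hcon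
  have h0 : fourierCoeff v.1 0 = 0 := by
    rw [← norm_le_zero_iff]
    refine ge_of_tendsto' (by simpa using (tendsto_fourierCoeff v.1).norm) fun k => ?_
    rw [hco, norm_smul, norm_pow]
    exact le_mul_of_one_le_left (norm_nonneg _) (one_le_pow₀ hcon)
  refine hv.2 (Subtype.ext (eq_zero_of_fourierCoeff fun n => ?_))
  rcases lt_or_ge n 0 with h | h
  · exact v.2.1 n h
  · lift n to ℕ using h
    rw [hco, h0, smul_zero]

theorem summable_norm_modelShift_pow (hΘ : Θ ∈ hardy (E →L[ℂ] E)) :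
    Summable fun k : ℕ => ‖modelShift hΘ ^ k‖ := by
  have h : ∀ c ∈ spectrum ℂ (modelShift hΘ), ‖c‖ < 1 :=
    fun _ => norm_lt_one_of_mem_spectrum_modelShift hΘ
  exact summable_opNorm_pow_of_spectrum h

theorem isBdd_of_mem_modelSpace (hΘ : Θ ∈ hardy (E →L[ℂ] E)) (f : modelSpace Θ) :
    IsBdd (f : LTwo E) := by
  refine isBdd_of_summable ?_
  have h0 : Summable fun k : ℕ => ‖fourierCoeff (f : LTwo E) k‖ := by
    refine Summable.of_nonneg_of_le (fun _ => norm_nonneg _) (fun k => ?_)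
      ((summable_norm_modelShift_pow hΘ).mul_right ‖f‖)
    rw [← zero_add (k : ℤ), ← fourierCoeff_modelShift_pow hΘ k f le_rfl]
    exact (norm_fourierCoeff_le _ _).trans ((modelShift hΘ ^ k).le_opNorm f)
  refine Summable.of_nat_of_neg_add_one h0 ?_
  have : ∀ k : ℕ, fourierCoeff (f : LTwo E) (-((k : ℤ) + 1)) = 0 := fun k => f.2.1 _ (by omega)
  simp only [this, norm_zero]
  exact summable_zero

end ModelShift

/-! ### Displacement operators and the dimension count -/

section Displacement

open ContinuousLinearMap

variable {E K : Type*} [NormedAddCommGroup E] [InnerProductSpace ℂ E]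
  [CompleteSpace E] [NormedAddCommGroup K] [InnerProductSpace ℂ K] [CompleteSpace K]

/-- The displacement map `A ↦ A - T† A T`. -/
def displacement (T : K →L[ℂ] K) : (K →L[ℂ] K) →ₗ[ℂ] (K →L[ℂ] K) where
  toFun A := A - adjoint T ∘L A ∘L T
  map_add' A B := by
    rw [ContinuousLinearMap.add_comp, ContinuousLinearMap.comp_add]
    abel
  map_smul' c A := by
    rw [ContinuousLinearMap.smul_comp, ContinuousLinearMap.comp_smul, smul_sub, RingHom.id_apply]

theorem displacement_apply (T A : K →L[ℂ] K) :
    displacement T A = A - adjoint T ∘L A ∘L T := rfl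

theorem inner_displacement (T A : K →L[ℂ] K) (g f : K) :
    ⟪g, displacement T A f⟫_ℂ = ⟪g, A f⟫_ℂ - ⟪T g, A (T f)⟫_ℂ := by
  rw [displacement_apply, sub_apply, inner_sub_right, comp_apply, comp_apply,
    adjoint_inner_right]

theorem displacement_adjoint (T A : K →L[ℂ] K) :
    displacement T (adjoint A) = adjoint (displacement T A) := by
  rw [displacement_apply, displacement_apply, map_sub, adjoint_comp, adjoint_comp, adjoint_adjoint]
  rfl

/-- Iterating `A = T† A T` gives `A = (T†)^k A T^k`, which tends to 0. -/
theorem displacement_injective {T : K →L[ℂ] K} (hT : Summable fun k : ℕ => ‖T ^ k‖) :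
    Function.Injective (displacement T) := by
  refine (injective_iff_map_eq_zero _).2 fun A hA => ?_
  have h : A = adjoint T ∘L A ∘L T := sub_eq_zero.1 hA
  have hk : ∀ k : ℕ, ∀ g f, ⟪g, A f⟫_ℂ = ⟪(T ^ k) g, A ((T ^ k) f)⟫_ℂ := fun k => by
    induction k with
    | zero => simp
    | succ k ih =>
      intro g f
      rw [ih, h, comp_apply, comp_apply, adjoint_inner_right, ← h, pow_succ',
        mul_apply_eq_comp, mul_apply_eq_comp]
  refine ContinuousLinearMap.ext fun f => ext_inner_left ℂ fun g => ?_
  rw [zero_apply, inner_zero_right, ← norm_le_zero_iff]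
  have h0 := hT.tendsto_atTop_zero
  have hlim : Filter.Tendsto (fun k : ℕ => ‖T ^ k‖ * ‖g‖ * (‖A‖ * (‖T ^ k‖ * ‖f‖)))
      Filter.atTop (nhds 0) := by
    simpa using (h0.mul_const ‖g‖).mul ((h0.mul_const ‖f‖).const_mul ‖A‖)
  refine ge_of_tendsto' hlim fun k => ?_
  rw [hk k]
  refine (norm_inner_le_norm _ _).trans ?_
  gcongr
  · exact (T ^ k).le_opNorm g
  · exact A.le_opNorm_of_le ((T ^ k).le_opNorm f)

/-- The map `(X, Y) ↦ J X + Y J†`. -/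
def defectMap (J : E →L[ℂ] K) : (K →L[ℂ] E) × (E →L[ℂ] K) →ₗ[ℂ] (K →L[ℂ] K) where
  toFun p := J ∘L p.1 + p.2 ∘L adjoint J
  map_add' p q := by
    simp only [Prod.fst_add, Prod.snd_add, ContinuousLinearMap.add_comp,
      ContinuousLinearMap.comp_add]
    abel
  map_smul' c p := by
    simp only [Prod.smul_fst, Prod.smul_snd, ContinuousLinearMap.smul_comp,
      ContinuousLinearMap.comp_smul, smul_add, RingHom.id_apply]

/-- The parametrisation `M ↦ (-M J†, J M)` of the kernel of `defectMap J`. -/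
def defectKer (J : E →L[ℂ] K) : (E →L[ℂ] E) →ₗ[ℂ] (K →L[ℂ] E) × (E →L[ℂ] K) where
  toFun M := (-(M ∘L adjoint J), J ∘L M)
  map_add' M N := by
    simp only [ContinuousLinearMap.add_comp, ContinuousLinearMap.comp_add, neg_add, Prod.mk_add_mk]
  map_smul' c M := by
    simp only [ContinuousLinearMap.smul_comp, ContinuousLinearMap.comp_smul, RingHom.id_apply,
      Prod.smul_mk, smul_neg]

theorem defectKer_injective {J : E →L[ℂ] K} (hJ : Function.Injective J) :
    Function.Injective (defectKer J) := fun M N h => by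
  refine ContinuousLinearMap.ext fun e => hJ ?_
  exact congrArg (fun p => p.2 e) h

theorem exists_leftInverse_of_injective {E K : Type*} [NormedAddCommGroup E] [NormedSpace ℂ E]
    [NormedAddCommGroup K] [NormedSpace ℂ K] [FiniteDimensional ℂ K] {J : E →L[ℂ] K} (hJ : Function.Injective J) :
    ∃ L : K →L[ℂ] E, L ∘L J = ContinuousLinearMap.id ℂ E := by
  obtain ⟨L, hL⟩ := LinearMap.exists_leftInverse_of_injective J.toLinearMap
    (LinearMap.ker_eq_bot.2 hJ)
  refine ⟨L.toContinuousLinearMap, ContinuousLinearMap.ext fun e => ?_⟩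
  exact LinearMap.congr_fun hL e

/-- With `L` a left inverse of `J`, multiply `J X = -Y J†` by `L` on the left to get `X = -(L Y)
J†`, and by `L†` on the right to see that `Y` factors through `J`. Thus `M = L Y` serves both
components. -/
theorem range_defectKer [FiniteDimensional ℂ K] {J : E →L[ℂ] K} (hJ : Function.Injective J) :
    LinearMap.range (defectKer J) = LinearMap.ker (defectMap J) := by
  obtain ⟨L, hL⟩ := exists_leftInverse_of_injective hJ
  have hL' : adjoint J ∘L adjoint L = ContinuousLinearMap.id ℂ E := by
    rw [← adjoint_comp, hL]
    exact adjoint_id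
  apply le_antisymm
  · rintro _ ⟨M, rfl⟩
    refine LinearMap.mem_ker.2 ?_
    change J ∘L (-(M ∘L adjoint J)) + (J ∘L M) ∘L adjoint J = 0
    rw [ContinuousLinearMap.comp_neg, ContinuousLinearMap.comp_assoc, neg_add_cancel]
  · rintro ⟨X, Y⟩ h
    have h' : J ∘L X + Y ∘L adjoint J = 0 := h
    have h1 : X = -((L ∘L Y) ∘L adjoint J) := by
      rw [ContinuousLinearMap.comp_assoc, ← ContinuousLinearMap.comp_neg,
        ← eq_neg_of_add_eq_zero_left h', ← ContinuousLinearMap.comp_assoc, hL,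
        ContinuousLinearMap.id_comp]
    have h2 : Y = -(J ∘L X ∘L adjoint L) := by
      rw [← ContinuousLinearMap.comp_assoc, eq_neg_of_add_eq_zero_left h',
        ContinuousLinearMap.neg_comp, neg_neg, ContinuousLinearMap.comp_assoc, hL',
        ContinuousLinearMap.comp_id]
    refine ⟨L ∘L Y, Prod.ext h1.symm ?_⟩
    change J ∘L L ∘L Y = Y
    rw [h2, ContinuousLinearMap.comp_neg, ContinuousLinearMap.comp_neg,
      ← ContinuousLinearMap.comp_assoc L, hL, ContinuousLinearMap.id_comp]

theorem finrank_clm {V W : Type*} [NormedAddCommGroup V] [NormedSpace ℂ V] [FiniteDimensional ℂ V]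
    [NormedAddCommGroup W] [NormedSpace ℂ W] [FiniteDimensional ℂ W] :
    Module.finrank ℂ (V →L[ℂ] W) = Module.finrank ℂ V * Module.finrank ℂ W := by
  rw [← (LinearMap.toContinuousLinearMap (𝕜 := ℂ) (E := V) (F' := W)).finrank_eq,
    Module.finrank_linearMap]

variable [FiniteDimensional ℂ E] [FiniteDimensional ℂ K]

theorem finrank_range_defectMap {J : E →L[ℂ] K} (hJ : Function.Injective J) :
    Module.finrank ℂ (LinearMap.range (defectMap J)) + Module.finrank ℂ E ^ 2
      = 2 * Module.finrank ℂ K * Module.finrank ℂ E := by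
  have h := LinearMap.finrank_range_add_finrank_ker (defectMap J)
  rw [← range_defectKer hJ, LinearMap.finrank_range_of_inj (defectKer_injective hJ),
    Module.finrank_prod, finrank_clm, finrank_clm, finrank_clm] at h
  rw [sq, h]
  ring

/-- The dimension of an adjoint-closed space of operators whose displacements with respect to a
stable `T` are the operators of the form `J X + Y J†`. -/
theorem finrank_of_displacement {T : K →L[ℂ] K} (hT : Summable fun k : ℕ => ‖T ^ k‖)
    {J : E →L[ℂ] K} (hJ : Function.Injective J) (M : Submodule ℂ (K →L[ℂ] K))
    (hM : ∀ A ∈ M, adjoint A ∈ M)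
    (h₁ : ∀ A ∈ M, ∃ X Y, displacement T A = J ∘L X + Y ∘L adjoint J)
    (h₂ : ∀ Y : E →L[ℂ] K, ∃ A ∈ M, displacement T A = Y ∘L adjoint J) :
    Module.finrank ℂ M + Module.finrank ℂ E ^ 2
      = 2 * Module.finrank ℂ K * Module.finrank ℂ E := by
  have hinj := displacement_injective hT
  have hrange : M.map (displacement T) = LinearMap.range (defectMap J) := by
    apply le_antisymm
    · rintro _ ⟨A, hA, rfl⟩
      obtain ⟨X, Y, h⟩ := h₁ A hA
      exact ⟨(X, Y), h.symm⟩
    · rintro _ ⟨⟨X, Y⟩, rfl⟩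
      -- The displacement of `A` is `X† J†`, so that of `A†` is `J X`.
      obtain ⟨A, hA, h⟩ := h₂ (adjoint X)
      obtain ⟨B, hB, h'⟩ := h₂ Y
      refine ⟨adjoint A + B, add_mem (hM A hA) hB, ?_⟩
      rw [map_add, displacement_adjoint, h, h', adjoint_comp, adjoint_adjoint, adjoint_adjoint]
      rfl
  rw [← finrank_range_defectMap hJ, ← hrange,
    (Submodule.equivMapOfInjective (displacement T) hinj M).finrank_eq]

end Displacement

/-! ### Symbols, the defect map and displacements of Toeplitz operators -/

section Symbols

variable {E : Type*} [NormedAddCommGroup E] [InnerProductSpace ℂ E]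

theorem coeFn_mulBdd (Φ : LTwo (E →L[ℂ] E)) {f : LTwo E} (hf : IsBdd f) :
    mulBdd Φ f hf =ᵐ[torusMeasure] fun t => Φ t (f t) :=
  MemLp.coeFn_toLp (memLp_mul Φ hf)

/-- The subspace of bounded functions in `L²(E)`. -/
def bddSubmodule (E : Type*) [NormedAddCommGroup E] [InnerProductSpace ℂ E] :
    Submodule ℂ (LTwo E) where
  carrier := {f | IsBdd f}
  zero_mem' := (memLp_congr_ae (Lp.coeFn_zero E 2 torusMeasure)).2 MemLp.zero
  add_mem' := fun {f g} hf hg => (memLp_congr_ae (Lp.coeFn_add f g)).2 (MemLp.add hf hg)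
  smul_mem' := fun c f hf => (memLp_congr_ae (Lp.coeFn_smul c f)).2 (MemLp.const_smul hf c)

theorem constTwo_mem_bddSubmodule (e : E) : constTwo e ∈ bddSubmodule E :=
  (memLp_congr_ae (coeFn_constTwo e)).2 (memLp_top_const e)

theorem charMul_mem_bddSubmodule (k : ℤ) {f : LTwo E} (hf : f ∈ bddSubmodule E) :
    charMul k f ∈ bddSubmodule E := by
  refine MemLp.of_le (g := f) hf (Lp.aestronglyMeasurable _) ?_
  filter_upwards [coeFn_charMul k f] with t a
  rw [a, norm_smul, fourier_apply, Circle.norm_coe, one_mul]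

/-- The multiplication by `Φ`, as a linear map on the bounded functions. -/
def mulL (Φ : LTwo (E →L[ℂ] E)) : bddSubmodule E →ₗ[ℂ] LTwo E where
  toFun f := mulBdd Φ f f.2
  map_add' f g := by
    apply Lp.ext
    filter_upwards [coeFn_mulBdd Φ (f + g).2, coeFn_mulBdd Φ f.2, coeFn_mulBdd Φ g.2,
      Lp.coeFn_add (mulBdd Φ f f.2) (mulBdd Φ g g.2), Lp.coeFn_add (f : LTwo E) g] with t a b c e k
    rw [a, e, Pi.add_apply, b, c, ← map_add]
    exact congrArg _ k
  map_smul' r f := by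
    apply Lp.ext
    filter_upwards [coeFn_mulBdd Φ (r • f).2, coeFn_mulBdd Φ f.2,
      Lp.coeFn_smul r (mulBdd Φ f f.2), Lp.coeFn_smul r (f : LTwo E)] with t a b e k
    rw [a, RingHom.id_apply, e, Pi.smul_apply, b, ← map_smul]
    exact congrArg _ k

theorem coeFn_mulL (Φ : LTwo (E →L[ℂ] E)) (f : bddSubmodule E) :
    mulL Φ f =ᵐ[torusMeasure] fun t => Φ t ((f : LTwo E) t) := coeFn_mulBdd Φ f.2

/-- The constant functions, as bounded functions. -/
def constBdd : E →ₗ[ℂ] bddSubmodule E :=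
  (constTwo : E →L[ℂ] LTwo E).toLinearMap.codRestrict _ constTwo_mem_bddSubmodule

theorem inner_mulL_charMul (Φ : LTwo (E →L[ℂ] E)) (k : ℤ) (g : LTwo E) (f : bddSubmodule E) :
    ⟪charMul k g, mulL Φ ⟨charMul k f, charMul_mem_bddSubmodule k f.2⟩⟫_ℂ = ⟪g, mulL Φ f⟫_ℂ := by
  rw [← inner_charMul_charMul k g]
  congr 1
  apply Lp.ext
  filter_upwards [coeFn_mulL Φ ⟨charMul k f, charMul_mem_bddSubmodule k f.2⟩, coeFn_mulL Φ f,
    coeFn_charMul k (mulL Φ f), coeFn_charMul k (f : LTwo E)] with t a b c e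
  rw [a, c, b, e, map_smul]

variable [CompleteSpace E] {Θ : LTwo (E →L[ℂ] E)}

theorem inner_modelProj (f : modelSpace Θ) (g : LTwo E) :
    ⟪f, modelProj Θ g⟫_ℂ = ⟪(f : LTwo E), g⟫_ℂ :=
  Submodule.inner_orthogonalProjectionOnto_eq_of_mem_left f g

variable [FiniteDimensional ℂ E]

/-- The map `e ↦ P_Θ e` from constants to the model space. -/
def defect (Θ : LTwo (E →L[ℂ] E)) : E →L[ℂ] modelSpace Θ := modelProj Θ ∘L constTwo

theorem adjoint_defect (f : modelSpace Θ) :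
    ContinuousLinearMap.adjoint (defect Θ) f = fourierCoeff (f : LTwo E) 0 := by
  refine ext_inner_left ℂ fun e => ?_
  rw [ContinuousLinearMap.adjoint_inner_right, ← inner_constTwo_left, ← inner_conj_symm,
    defect, ContinuousLinearMap.comp_apply, inner_modelProj, inner_conj_symm]

theorem discValue_zero {F : Type*} [NormedAddCommGroup F] [NormedSpace ℂ F] (f : LTwo F) :
    discValue f 0 = fourierCoeff f 0 := by
  rw [discValue, tsum_eq_single 0 fun n hn => by simp [hn]]
  simp

/-- The function `e - Θ Θ(0)† e` lies in `K_Θ`; it is the reproducing kernel at 0. If `P_Θ e = 0`,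
pairing it with `e` gives `‖e‖ = ‖Θ(0)† e‖`, and `‖Θ(0)‖ < 1` leaves only `e = 0`. -/
theorem defect_injective (hΘ : IsInner Θ) (hp : IsPure Θ) : Function.Injective (defect Θ) := by
  refine (injective_iff_map_eq_zero _).2 fun e he => ?_
  rw [IsPure, discValue_zero] at hp
  set B := fourierCoeff Θ 0 with hB
  set e' := ContinuousLinearMap.adjoint B e with he'
  let u : LTwo E := mulL Θ (constBdd e')
  have hu : u =ᵐ[torusMeasure] fun t => Θ t (constTwo e' t) := coeFn_mulL Θ (constBdd e')
  have hu_hardy : u ∈ hardy E := mem_hardy_of_eq_mul hΘ.1 (constTwo_mem_hardy e') hu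
  have hu0 : fourierCoeff u 0 = B e' := by
    rw [fourierCoeff_zero_of_eq_mul hΘ.1 (constTwo_mem_hardy e') hu, fourierCoeff_constTwo,
      if_pos rfl]
  have hmem : constTwo e - u ∈ modelSpace Θ := by
    refine ⟨sub_mem (constTwo_mem_hardy e) hu_hardy, (Submodule.mem_orthogonal' _ _).2 ?_⟩
    rintro g ⟨h, hh, hg⟩
    -- Multiplication by `Θ` is isometric, its values being unitary almost everywhere.
    have h1 : ⟪u, g⟫_ℂ = ⟪constTwo e', h⟫_ℂ := by
      rw [L2.inner_def, L2.inner_def]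
      refine integral_congr_ae ?_
      filter_upwards [hu, hg, hΘ.2] with t a b c
      rw [a, b, ← ContinuousLinearMap.adjoint_inner_right, ← ContinuousLinearMap.comp_apply (ContinuousLinearMap.adjoint (Θ t))]
      have h2 : ContinuousLinearMap.adjoint (Θ t) ∘L Θ t = ContinuousLinearMap.id ℂ E :=
        (Unitary.mem_iff.1 c).1
      rw [h2, ContinuousLinearMap.id_apply]
    rw [inner_sub_left, h1, inner_constTwo_left, inner_constTwo_left,
      fourierCoeff_zero_of_eq_mul hΘ.1 hh hg, he', ContinuousLinearMap.adjoint_inner_left, sub_self]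
  have h3 : ⟪constTwo e, constTwo e - u⟫_ℂ = 0 := by
    rw [← inner_conj_symm, ← inner_modelProj ⟨_, hmem⟩]
    change starRingEnd ℂ ⟪_, defect Θ e⟫_ℂ = 0
    rw [he, inner_zero_right, map_zero]
  rw [inner_sub_right, inner_constTwo_left, inner_constTwo_left, fourierCoeff_constTwo,
    if_pos rfl, hu0, ← ContinuousLinearMap.adjoint_inner_left, ← he', sub_eq_zero,
    inner_self_eq_norm_sq_to_K, inner_self_eq_norm_sq_to_K] at h3
  have h4 : ‖e‖ ^ 2 = ‖e'‖ ^ 2 := by exact_mod_cast h3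
  have h5 : ‖e‖ = ‖e'‖ := by
    rwa [sq_eq_sq₀ (norm_nonneg _) (norm_nonneg _)] at h4
  have h6 : ‖e'‖ ≤ ‖B‖ * ‖e‖ := by
    rw [← LinearIsometryEquiv.norm_map ContinuousLinearMap.adjoint B]
    exact ContinuousLinearMap.le_opNorm _ e
  by_contra hne
  have h7 : 0 < ‖e‖ := norm_pos_iff.2 hne
  nlinarith

/-- The analytic symbol `t ↦ (e ↦ (Y e)(t))`. -/
def analyticSymbol (Y : E →L[ℂ] modelSpace Θ) : LTwo (E →L[ℂ] E) :=
  ∑ i, (ContinuousLinearMap.smulRightL ℂ E E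
    (innerSL ℂ (stdOrthonormalBasis ℂ E i))).compLp (Y (stdOrthonormalBasis ℂ E i) : LTwo E)

theorem analyticSymbol_mem_hardy (Y : E →L[ℂ] modelSpace Θ) :
    analyticSymbol Y ∈ hardy (E →L[ℂ] E) := by
  refine sum_mem fun i _ n hn => ?_
  rw [fourierCoeff_compLp, (Y _).2.1 n hn, map_zero]

theorem mulL_analyticSymbol_constBdd (Y : E →L[ℂ] modelSpace Θ) (e : E) :
    mulL (analyticSymbol Y) (constBdd e) = (Y e : LTwo E) := by
  let b := stdOrthonormalBasis ℂ E
  let R : Fin (Module.finrank ℂ E) → E →L[ℂ] E →L[ℂ] E := fun i =>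
    ContinuousLinearMap.smulRightL ℂ E E (innerSL ℂ (b i))
  have hR : ∀ i v, R i v e = ⟪b i, e⟫_ℂ • v := fun i v => rfl
  have hYe : (Y e : LTwo E) = ∑ i, ⟪b i, e⟫_ℂ • (Y (b i) : LTwo E) := by
    conv_lhs => rw [← b.sum_repr' e]
    simp only [map_sum, map_smul, Submodule.coe_sum, Submodule.coe_smul]
  apply Lp.ext
  rw [hYe]
  have h1 : analyticSymbol Y =ᵐ[torusMeasure] fun t => ∑ i, (R i).compLp (Y (b i) : LTwo E) t :=
    Lp.coeFn_fun_finsetSum Finset.univ fun i => (R i).compLp (Y (b i) : LTwo E)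
  have h2 := Lp.coeFn_fun_finsetSum Finset.univ fun i => ⟪b i, e⟫_ℂ • (Y (b i) : LTwo E)
  have h3 := ae_all_iff.2 fun i => (R i).coeFn_compLp (Y (b i) : LTwo E)
  have h4 := ae_all_iff.2 fun i => Lp.coeFn_smul ⟪b i, e⟫_ℂ (Y (b i) : LTwo E)
  filter_upwards [coeFn_mulL (analyticSymbol Y) (constBdd e), coeFn_constTwo e, h1, h2, h3, h4]
    with t a c k1 k2 k3 k4
  have c' : (constBdd e : LTwo E) t = e := c
  rw [a, c', k1, k2, sum_apply]
  refine Finset.sum_congr rfl fun i _ => ?_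
  rw [k3, hR, k4, Pi.smul_apply]

variable [FiniteDimensional ℂ (modelSpace Θ)]

/-- The inclusion of the model space into the bounded functions. -/
def modelBdd (hΘ : Θ ∈ hardy (E →L[ℂ] E)) : modelSpace Θ →ₗ[ℂ] bddSubmodule E :=
  (modelSpace Θ).subtype.codRestrict _ (isBdd_of_mem_modelSpace hΘ)

/-- The truncated Toeplitz operator with symbol `Φ`. -/
def toeplitzOp (hΘ : Θ ∈ hardy (E →L[ℂ] E)) (Φ : LTwo (E →L[ℂ] E)) :
    modelSpace Θ →L[ℂ] modelSpace Θ :=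
  ((modelProj Θ).toLinearMap ∘ₗ mulL Φ ∘ₗ modelBdd hΘ).toContinuousLinearMap

theorem toeplitzOp_apply (hΘ : Θ ∈ hardy (E →L[ℂ] E)) (Φ : LTwo (E →L[ℂ] E)) (f : modelSpace Θ) :
    toeplitzOp hΘ Φ f = modelProj Θ (mulL Φ (modelBdd hΘ f)) := rfl

/-- Every function in `K_Θ` is bounded, so a symbol determines its operator everywhere and every
`L²` symbol is admissible. -/
theorem mem_toeplitzSpace_iff (hΘ : Θ ∈ hardy (E →L[ℂ] E))
    {A : modelSpace Θ →L[ℂ] modelSpace Θ} :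
    A ∈ toeplitzSpace Θ ↔ ∃ Φ, A = toeplitzOp hΘ Φ := by
  refine exists_congr fun Φ => ⟨fun h => ?_, ?_⟩
  · exact ContinuousLinearMap.ext fun f => h f (isBdd_of_mem_modelSpace hΘ f)
  · rintro rfl f hf
    rfl

theorem inner_toeplitzOp (hΘ : Θ ∈ hardy (E →L[ℂ] E)) (Φ : LTwo (E →L[ℂ] E))
    (g f : modelSpace Θ) :
    ⟪g, toeplitzOp hΘ Φ f⟫_ℂ = ⟪(g : LTwo E), mulL Φ (modelBdd hΘ f)⟫_ℂ := by
  rw [toeplitzOp_apply, inner_modelProj]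

theorem adjoint_toeplitzOp (hΘ : Θ ∈ hardy (E →L[ℂ] E)) (Φ : LTwo (E →L[ℂ] E)) :
    ContinuousLinearMap.adjoint (toeplitzOp hΘ Φ) = toeplitzOp hΘ (star Φ) := by
  refine ContinuousLinearMap.ext fun f => ext_inner_left ℂ fun g => ?_
  rw [ContinuousLinearMap.adjoint_inner_right, ← inner_conj_symm, inner_toeplitzOp,
    inner_toeplitzOp, inner_conj_symm, L2.inner_def, L2.inner_def]
  refine integral_congr_ae ?_
  filter_upwards [coeFn_mulL Φ (modelBdd hΘ g), coeFn_mulL (star Φ) (modelBdd hΘ f),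
    Lp.coeFn_star Φ] with t a b c
  rw [a, b, c, Pi.star_apply, ContinuousLinearMap.star_eq_adjoint,
    ContinuousLinearMap.adjoint_inner_right]
  rfl

/-- The function `f - f(0)`, for `f` in the model space. -/
def subConst (hΘ : Θ ∈ hardy (E →L[ℂ] E)) : modelSpace Θ →ₗ[ℂ] bddSubmodule E :=
  modelBdd hΘ - constBdd ∘ₗ (ContinuousLinearMap.adjoint (defect Θ)).toLinearMap

theorem coe_subConst (hΘ : Θ ∈ hardy (E →L[ℂ] E)) (f : modelSpace Θ) :
    (subConst hΘ f : LTwo E) = f - constTwo (fourierCoeff (f : LTwo E) 0) := by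
  rw [← adjoint_defect]
  rfl

/-- The factors `e^{-it}` of the two shifts cancel, leaving `⟪g, Φ f⟫ - ⟪g - g(0), Φ (f - f(0))⟫`,
which equals `⟪g, Φ f(0)⟫ + ⟪g(0), Φ (f - f(0))⟫`. -/
theorem inner_displacement_toeplitzOp (hΘ : Θ ∈ hardy (E →L[ℂ] E)) (Φ : LTwo (E →L[ℂ] E))
    (g f : modelSpace Θ) :
    ⟪g, displacement (modelShift hΘ) (toeplitzOp hΘ Φ) f⟫_ℂ
      = ⟪g, modelProj Θ (mulL Φ (constBdd (ContinuousLinearMap.adjoint (defect Θ) f)))⟫_ℂ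
        + ⟪ContinuousLinearMap.adjoint (defect Θ) g, fourierCoeff (mulL Φ (subConst hΘ f)) 0⟫_ℂ := by
  have hshift : ∀ h : modelSpace Θ, (modelShift hΘ h : LTwo E) = charMul (-1) (subConst hΘ h) :=
    fun h => by rw [coe_subConst, coe_modelShift, backShift_apply]
  have h1 : modelBdd hΘ (modelShift hΘ f)
      = ⟨charMul (-1) (subConst hΘ f), charMul_mem_bddSubmodule (-1) (subConst hΘ f).2⟩ :=
    Subtype.ext (hshift f)
  have h2 : modelBdd hΘ f
      = constBdd (ContinuousLinearMap.adjoint (defect Θ) f) + subConst hΘ f :=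
    (add_sub_cancel _ _).symm
  rw [inner_displacement, inner_toeplitzOp, inner_toeplitzOp, hshift g, h1, inner_mulL_charMul,
    coe_subConst, h2, map_add, inner_add_right, inner_sub_left, inner_modelProj,
    inner_constTwo_left, adjoint_defect, adjoint_defect]
  ring

theorem displacement_toeplitzOp (hΘ : Θ ∈ hardy (E →L[ℂ] E)) (Φ : LTwo (E →L[ℂ] E)) :
    displacement (modelShift hΘ) (toeplitzOp hΘ Φ)
      = defect Θ ∘L ((coeffL 0).toLinearMap ∘ₗ mulL Φ ∘ₗ subConst hΘ).toContinuousLinearMap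
        + ((modelProj Θ).toLinearMap ∘ₗ mulL Φ ∘ₗ constBdd).toContinuousLinearMap
          ∘L ContinuousLinearMap.adjoint (defect Θ) := by
  refine ContinuousLinearMap.ext fun f => ext_inner_left ℂ fun g => ?_
  rw [inner_displacement_toeplitzOp, add_apply, inner_add_right, add_comm,
    ContinuousLinearMap.adjoint_inner_left]
  rfl

/-- For an analytic symbol `Φ (f - f(0))` has zero constant term, so only the term `Φ f(0) = Y
(f(0))` survives, and it already lies in `K_Θ`. -/
theorem displacement_toeplitzOp_analyticSymbol (hΘ : Θ ∈ hardy (E →L[ℂ] E))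
    (Y : E →L[ℂ] modelSpace Θ) :
    displacement (modelShift hΘ) (toeplitzOp hΘ (analyticSymbol Y))
      = Y ∘L ContinuousLinearMap.adjoint (defect Θ) := by
  refine ContinuousLinearMap.ext fun f => ext_inner_left ℂ fun g => ?_
  have hmem : (subConst hΘ f : LTwo E) ∈ hardy E := by
    rw [coe_subConst]
    exact sub_mem f.2.1 (constTwo_mem_hardy _)
  have h0 : fourierCoeff (mulL (analyticSymbol Y) (subConst hΘ f)) 0 = 0 := by
    rw [fourierCoeff_zero_of_eq_mul (analyticSymbol_mem_hardy Y) hmem (coeFn_mulL _ _),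
      coe_subConst, fourierCoeff_sub_constTwo, if_pos rfl, map_zero]
  rw [inner_displacement_toeplitzOp, h0, inner_zero_right, add_zero, mulL_analyticSymbol_constBdd,
    inner_modelProj]
  rfl

theorem finrank_toeplitzSpace (hΘ : IsInner Θ) (hp : IsPure Θ) :
    Module.finrank ℂ (toeplitzSpace Θ) + Module.finrank ℂ E ^ 2
      = 2 * Module.finrank ℂ (modelSpace Θ) * Module.finrank ℂ E := by
  refine finrank_of_displacement (summable_norm_modelShift_pow hΘ.1) (defect_injective hΘ hp)
    (toeplitzSpace Θ) ?_ ?_ ?_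
  · intro A hA
    obtain ⟨Φ, rfl⟩ := (mem_toeplitzSpace_iff hΘ.1).1 hA
    exact (mem_toeplitzSpace_iff hΘ.1).2 ⟨star Φ, adjoint_toeplitzOp hΘ.1 Φ⟩
  · intro A hA
    obtain ⟨Φ, rfl⟩ := (mem_toeplitzSpace_iff hΘ.1).1 hA
    exact ⟨_, _, displacement_toeplitzOp hΘ.1 Φ⟩
  · intro Y
    exact ⟨_, (mem_toeplitzSpace_iff hΘ.1).2 ⟨_, rfl⟩,
      displacement_toeplitzOp_analyticSymbol hΘ.1 Y⟩

end Symbols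

end MTTO

end

theorem mainTheorem5 {E : Type*} [NormedAddCommGroup E] [InnerProductSpace ℂ E]
    [CompleteSpace E] [FiniteDimensional ℂ E] (d : ℕ) (hd : Module.finrank ℂ E = d)
    (Θ : MTTO.LTwo (E →L[ℂ] E)) (hinner : MTTO.IsInner Θ) (hpure : MTTO.IsPure Θ)
    (n : ℕ) (hfin : FiniteDimensional ℂ (MTTO.modelSpace Θ))
    (hn : Module.finrank ℂ (MTTO.modelSpace Θ) = n) :
    FiniteDimensional ℂ (MTTO.toeplitzSpace Θ) ∧
      (Module.finrank ℂ (MTTO.toeplitzSpace Θ) : ℤ) = 2 * n * d - d ^ 2 := by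
  have h := MTTO.finrank_toeplitzSpace hinner hpure
  rw [hd, hn] at h
  -- The count was proved additively in `ℕ`; the subtraction is carried out in `ℤ`, where it does
  -- not truncate.
  exact ⟨inferInstance, by zify at h; linarith⟩
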